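/- Let $C_3\subset\mathbb{P}^2_{\mathbb{Q}}$ be the plane projective cubic curve defined by the sum of all monomials of degree $3$, \[ \sum_{\substack{h,i,j\ge 0\\ h+i+j=3}} x^h y^i z^j = 0 , \] and let $E$ be the projective Weierstrass curve over $\mathbb{Q}$ with affine equation \[ E\colon\quad y^2+xy+y=x^3-x-2 , \] that is, the curve with label $50a1$ in Cremona's tables. Then: 1. The set of rational points of $C_3$ is \[ C_3(\mathbb{Q}) = \{(1:-1:0),\ (-1:0:1),\ (0:1:-1)\} , \] and these three points are distinct. 2. $C_3$ is isomorphic to $E$ over $\mathbb{Q}$ (as a scheme over $\operatorname{Spec}\mathbb{Q}$). 3. $E$ is an elliptic curve (its discriminant is non-zero), the Mordell--Weil group $E(\mathbb{Q})$ has rank $0$, and $E$ has exactly three rational points, counting the point at infinity. -/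

import Mathlib

open MvPolynomial

/-! ### Plane projective curves as schemes -/

namespace PlaneCurve

universe u

/-- The homogeneous coordinate ring `k[x, y, z] / (F)` of the plane curve `F = 0`. -/
abbrev CoordRing {k : Type u} [Field k] (F : MvPolynomial (Fin 3) k) : Type u :=
  MvPolynomial (Fin 3) k ⧸ Ideal.span {F}

/-- The degree `n` part of `k[x, y, z] / (F)`: the classes of the forms of degree `n`. -/
noncomputable def grading {k : Type u} [Field k] (F : MvPolynomial (Fin 3) k) (n : ℕ) :
    Submodule k (CoordRing F) :=
  (homogeneousSubmodule (Fin 3) k n).map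
    (Ideal.Quotient.mkₐ k (Ideal.span {F})).toLinearMap

theorem mk_mem_grading {k : Type u} [Field k] (F : MvPolynomial (Fin 3) k) {n : ℕ}
    {p : MvPolynomial (Fin 3) k} (hp : p.IsHomogeneous n) :
    Ideal.Quotient.mk (Ideal.span {F}) p ∈ grading F n :=
  ⟨p, hp, rfl⟩

instance gradedMonoid {k : Type u} [Field k] (F : MvPolynomial (Fin 3) k) :
    SetLike.GradedMonoid (grading F) where
  one_mem := ⟨1, isHomogeneous_one (Fin 3) k, map_one (Ideal.Quotient.mkₐ k (Ideal.span {F}))⟩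
  mul_mem := by
    rintro i j _ _ ⟨p, hp, rfl⟩ ⟨q, hq, rfl⟩
    exact ⟨p * q, IsHomogeneous.mul hp hq, map_mul (Ideal.Quotient.mkₐ k (Ideal.span {F})) p q⟩

/-- The map from forms of degree `n` to `⨁ₙ (k[x, y, z] / (F))ₙ`. -/
noncomputable def componentMap {k : Type u} [Field k] (F : MvPolynomial (Fin 3) k) (n : ℕ) :
    homogeneousSubmodule (Fin 3) k n →ₗ[k] DirectSum ℕ (fun n => grading F n) :=
  (DirectSum.lof k ℕ (fun n => grading F n) n).comp
    ((Ideal.Quotient.mkₐ k (Ideal.span {F})).toLinearMap.restrict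
      (fun _ hp => mk_mem_grading F hp))

theorem componentMap_apply {k : Type u} [Field k] (F : MvPolynomial (Fin 3) k) {n : ℕ}
    {p : MvPolynomial (Fin 3) k} (hp : p.IsHomogeneous n) :
    componentMap F n ⟨p, hp⟩ = DirectSum.of (fun n => grading F n) n
      ⟨Ideal.Quotient.mk (Ideal.span {F}) p, mk_mem_grading F hp⟩ := rfl

section

attribute [local instance] MvPolynomial.gradedAlgebra

theorem componentMap_one {k : Type u} [Field k] (F : MvPolynomial (Fin 3) k) :
    componentMap F 0 (GradedMonoid.GOne.one
      (A := fun n => homogeneousSubmodule (Fin 3) k n)) = 1 :=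
  componentMap_apply F (isHomogeneous_one (Fin 3) k)

theorem componentMap_mul {k : Type u} [Field k] (F : MvPolynomial (Fin 3) k) {i j : ℕ}
    (a : homogeneousSubmodule (Fin 3) k i) (b : homogeneousSubmodule (Fin 3) k j) :
    componentMap F (i + j) (GradedMonoid.GMul.mul
      (A := fun n => homogeneousSubmodule (Fin 3) k n) a b) =
      componentMap F i a * componentMap F j b := by
  obtain ⟨p, hp⟩ := a
  obtain ⟨q, hq⟩ := b
  rw [componentMap_apply F hp, componentMap_apply F hq, DirectSum.of_mul_of]
  exact componentMap_apply F (IsHomogeneous.mul hp hq)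

/-- The map `k[x, y, z] → ⨁ₙ (k[x, y, z] / (F))ₙ` splitting a polynomial into the classes of its
homogeneous components. -/
noncomputable def decomposeAux {k : Type u} [Field k] (F : MvPolynomial (Fin 3) k) :
    MvPolynomial (Fin 3) k →ₐ[k] DirectSum ℕ (fun n => grading F n) :=
  (DirectSum.toAlgebra k (fun n => homogeneousSubmodule (Fin 3) k n) (componentMap F)
    (componentMap_one F) (componentMap_mul F)).comp
    (DirectSum.decomposeAlgEquiv (fun n => homogeneousSubmodule (Fin 3) k n)).toAlgHom

theorem decomposeAux_of_isHomogeneous {k : Type u} [Field k] (F : MvPolynomial (Fin 3) k) {n : ℕ}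
    {p : MvPolynomial (Fin 3) k} (hp : p.IsHomogeneous n) :
    decomposeAux F p = DirectSum.of (fun n => grading F n) n
      ⟨Ideal.Quotient.mk (Ideal.span {F}) p, mk_mem_grading F hp⟩ := by
  have h : (DirectSum.decomposeAlgEquiv (fun n => homogeneousSubmodule (Fin 3) k n)).toAlgHom p =
      DirectSum.of (fun n => homogeneousSubmodule (Fin 3) k n) n ⟨p, hp⟩ :=
    DirectSum.decompose_of_mem _ hp
  rw [decomposeAux, AlgHom.comp_apply, h]
  exact (DirectSum.toAddMonoid_of _ _ _).trans (componentMap_apply F hp)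

end

/-- The grading of `k[x, y, z] / (F)` by degree, for a form `F`. -/
noncomputable abbrev gradedAlgebra {k : Type u} [Field k] {F : MvPolynomial (Fin 3) k} {d : ℕ}
    (hF : F.IsHomogeneous d) : GradedAlgebra (grading F) :=
  GradedAlgebra.ofAlgHom (grading F)
    (Ideal.Quotient.liftₐ (Ideal.span {F}) (decomposeAux F) (by
      have h0 : decomposeAux F F = 0 := by
        rw [decomposeAux_of_isHomogeneous F hF]
        convert map_zero (DirectSum.of (fun n => grading F n) d)
        exact Ideal.Quotient.eq_zero_iff_mem.2 (Ideal.mem_span_singleton_self F)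
      have hle : Ideal.span {F} ≤ RingHom.ker (decomposeAux F) :=
        (Ideal.span_singleton_le_iff_mem _).2 h0
      exact fun a ha => hle ha))
    (by
      refine Ideal.Quotient.algHom_ext k (MvPolynomial.algHom_ext fun i => ?_)
      change DirectSum.coeAlgHom (grading F) (decomposeAux F (X i)) = _
      rw [decomposeAux_of_isHomogeneous F (isHomogeneous_X k i), DirectSum.coeAlgHom_of]
      rfl)
    (by
      rintro n ⟨_, p, hp, rfl⟩
      exact decomposeAux_of_isHomogeneous F hp)

/-- The plane projective curve `F = 0` over `k`, as the scheme `Proj k[x, y, z] / (F)`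
over `Spec k`. -/
noncomputable def scheme {k : Type u} [Field k] {F : MvPolynomial (Fin 3) k} {d : ℕ}
    (hF : F.IsHomogeneous d) :
    CategoryTheory.Over (AlgebraicGeometry.Spec (CommRingCat.of k)) :=
  letI := gradedAlgebra hF
  CategoryTheory.Over.mk
    (CategoryTheory.CategoryStruct.comp (AlgebraicGeometry.Proj.toSpecZero (grading F))
      (AlgebraicGeometry.Spec.map (CommRingCat.ofHom (algebraMap k (grading F 0)))))

/-- The set of `k`-rational points of the plane projective curve `F = 0`: the points of the
projective plane over `k` all of whose homogeneous coordinate vectors are zeros of `F`. -/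
def rationalPoints {k : Type u} [Field k] (F : MvPolynomial (Fin 3) k) :
    Set (Projectivization k (Fin 3 → k)) :=
  {P | ∀ (v : Fin 3 → k) (hv : v ≠ 0), Projectivization.mk k v hv = P → eval v F = 0}

end PlaneCurve

/-! ### The curves `C_d` -/

/-- The sum of all monomials `x ^ h * y ^ i * z ^ j` with `h + i + j = d`. -/
noncomputable def sumMonomials (d : ℕ) : MvPolynomial (Fin 3) ℚ :=
  ∑ e ∈ Finset.Nat.antidiagonalTuple 3 d, X 0 ^ e 0 * X 1 ^ e 1 * X 2 ^ e 2

theorem sumMonomials_isHomogeneous (d : ℕ) : (sumMonomials d).IsHomogeneous d := by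
  refine IsHomogeneous.sum _ _ _ fun e he => ?_
  rw [Finset.Nat.mem_antidiagonalTuple, Fin.sum_univ_three] at he
  rw [← he]
  exact ((isHomogeneous_X_pow 0 _).mul (isHomogeneous_X_pow 1 _)).mul (isHomogeneous_X_pow 2 _)

/-! ### The elliptic curve `50a1` -/

/-- The projective closure of a Weierstrass curve is a plane cubic. -/
theorem weierstrass_isHomogeneous (W : WeierstrassCurve ℚ) :
    W.toProjective.polynomial.IsHomogeneous 3 := by
  have hX := isHomogeneous_X ℚ (0 : Fin 3)
  have hY := isHomogeneous_X ℚ (1 : Fin 3)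
  have hZ := isHomogeneous_X ℚ (2 : Fin 3)
  unfold WeierstrassCurve.Projective.polynomial
  exact ((((hY.pow 2).mul hZ).add (((hX.C_mul _).mul hY).mul hZ)).add
    ((hY.C_mul _).mul (hZ.pow 2))).sub
    ((((hX.pow 3).add (((hX.pow 2).C_mul _).mul hZ)).add
    ((hX.C_mul _).mul (hZ.pow 2))).add ((hZ.pow 3).C_mul _))

/-- The elliptic curve with Cremona label `50a1` (LMFDB label `50.a3`), given by its reduced
minimal Weierstrass equation `y² + xy + y = x³ - x - 2`. -/
def curve50a1 : WeierstrassCurve ℚ := ⟨1, 0, 1, -1, -2⟩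

/-! Put s = x + y + z. The cubic form of `C₃` equals 5s³ - (2s - x)(2s - y)(2s - z), and the three
factors sum to 5s. Everything about rational points thus reduces to
`eq_zero_of_mul_eq_five_mul_cube`: uvw = 5s³ and u + v + w = 5s force s = 0. On the line s = 0 the
cubic is xyz, which leaves three points.

That statement is proved by infinite descent along two maps of degree 3. If a solution is primitive
and 5 ∣ w, coprimality gives u = a³, v = b³, w = 5c³, s = abc, hence a³ + b³ + 5c³ = 5abc
(`exists_curve_of_primitive`). With A = 3a, B = 3b, C = 5c, the factorisation of A³ + B³ + C³ - 3ABC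
turns this into (A + B + C) · N = -10c³, where N is a norm from ℤ[ω]. Up to powers of 3 the factors
(A + B + C)/10 and N are coprime, so both are cubes. Unique factorisation in ℤ[ω] then makes the
element of norm N a cube (p + qω)³. Eliminating a, b, c leaves a solution of the original system
with s replaced by a proper divisor r (`exists_smaller_of_five_dvd`).

The isomorphism with `50a1` is an invertible linear substitution. It induces mutually inverse graded
maps of coordinate rings, hence an isomorphism of `Proj` over the base. The same substitution
carries the descent result to the affine points of `50a1`; a group of order 3 is torsion, so the
rank is 0. -/

/-! ### The Eisenstein integers -/

/-- The ring `ℤ[ω]` with `ω² = -1 - ω`. -/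
abbrev Eisenstein : Type := QuadraticAlgebra ℤ (-1) (-1)

namespace Eisenstein

theorem norm_eq (z : Eisenstein) : z.norm = z.re ^ 2 - z.re * z.im + z.im ^ 2 := by
  rw [QuadraticAlgebra.norm_def]; ring

theorem norm_nonneg (z : Eisenstein) : 0 ≤ z.norm := by
  rw [norm_eq]; nlinarith [sq_nonneg (z.re - z.im), sq_nonneg z.re, sq_nonneg z.im]

theorem norm_eq_zero {z : Eisenstein} : z.norm = 0 ↔ z = 0 := by
  refine ⟨fun h => ?_, fun h => by simp [h]⟩
  rw [norm_eq] at h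
  have h1 : z.re = 0 := by
    nlinarith [sq_nonneg (z.re - 2 * z.im), sq_nonneg z.re]
  have h2 : z.im = 0 := by
    nlinarith [sq_nonneg (z.im - 2 * z.re), sq_nonneg z.im]
  ext <;> simpa

theorem norm_pos {z : Eisenstein} (hz : z ≠ 0) : 0 < z.norm :=
  (norm_nonneg z).lt_of_ne fun h => hz (norm_eq_zero.1 h.symm)

theorem two_mul_abs_sub_mul_round_le (a : ℤ) {n : ℤ} (hn : 0 < n) :
    2 * |a - n * round (a / n : ℚ)| ≤ n := by
  have h := abs_sub_round (a / n : ℚ)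
  have hn' : (0 : ℚ) < n := by exact_mod_cast hn
  have h2 : ((a - n * round (a / n : ℚ) : ℤ) : ℚ) = n * (a / n - round (a / n : ℚ)) := by
    push_cast; field_simp
  have h3 : ((2 * |a - n * round (a / n : ℚ)| : ℤ) : ℚ) ≤ n := by
    rw [Int.cast_mul, Int.cast_abs, h2, abs_mul, abs_of_pos hn']
    push_cast
    nlinarith
  exact_mod_cast h3

/-- Division by rounding the coordinates of the exact quotient. -/
noncomputable def quot (x y : Eisenstein) : Eisenstein :=
  ⟨round ((x * star y).re / y.norm : ℚ), round ((x * star y).im / y.norm : ℚ)⟩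

/-- Multiplication by `star y` clears the denominator: (x - yq) · `star y` has coordinates e, f of
absolute value at most N(y)/2, so its norm e² - ef + f² is at most ¾N(y)². -/
theorem norm_sub_mul_quot_lt (x : Eisenstein) {y : Eisenstein} (hy : y ≠ 0) :
    (x - y * quot x y).norm < y.norm := by
  have hn := norm_pos hy
  have h1 := two_mul_abs_sub_mul_round_le (x * star y).re hn
  have h2 := two_mul_abs_sub_mul_round_le (x * star y).im hn
  have key : (x - y * quot x y) * star y = x * star y - (y.norm : Eisenstein) * quot x y := by
    rw [← QuadraticAlgebra.C_intCast, Int.cast_id, QuadraticAlgebra.C_eq_algebraMap,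
      QuadraticAlgebra.algebraMap_norm_eq_mul_star]
    ring
  have hmul : (x - y * quot x y).norm * y.norm =
      ((x * star y - (y.norm : Eisenstein) * quot x y)).norm := by
    rw [← key, map_mul, QuadraticAlgebra.norm_star]
  set e := (x * star y).re - y.norm * round ((x * star y).re / y.norm : ℚ) with he
  set f := (x * star y).im - y.norm * round ((x * star y).im / y.norm : ℚ) with hf
  have hre : (x * star y - (y.norm : Eisenstein) * quot x y).re = e := by
    rw [he, QuadraticAlgebra.re_sub, QuadraticAlgebra.re_mul (y.norm : Eisenstein)]
    simp [quot]
  have him : (x * star y - (y.norm : Eisenstein) * quot x y).im = f := by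
    rw [hf, QuadraticAlgebra.im_sub, QuadraticAlgebra.im_mul (y.norm : Eisenstein)]
    simp [quot]
  rw [norm_eq (x * star y - _), hre, him] at hmul
  have he2 : 4 * e ^ 2 ≤ y.norm ^ 2 := by
    nlinarith [sq_abs e, abs_nonneg e]
  have hf2 : 4 * f ^ 2 ≤ y.norm ^ 2 := by
    nlinarith [sq_abs f, abs_nonneg f]
  have : 4 * ((x - y * quot x y).norm * y.norm) ≤ 3 * y.norm ^ 2 := by
    nlinarith [sq_nonneg (e + f)]
  nlinarith

noncomputable instance : EuclideanDomain Eisenstein where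
  quotient := quot
  remainder x y := x - y * quot x y
  quotient_zero x := by simp [quot]; rfl
  quotient_mul_add_remainder_eq _ _ := by ring
  r := _
  r_wellFounded := (measure (Int.natAbs ∘ QuadraticAlgebra.norm)).wf
  remainder_lt x y hy := by
    have h1 := norm_sub_mul_quot_lt x hy
    have h2 := norm_nonneg (x - y * quot x y)
    change (x - y * quot x y).norm.natAbs < y.norm.natAbs
    omega
  mul_left_not_lt x y hy := by
    change ¬ (x * y).norm.natAbs < x.norm.natAbs
    rw [not_lt, map_mul, Int.natAbs_mul]
    exact Nat.le_mul_of_pos_right _ (Int.natAbs_pos.2 (norm_pos hy).ne')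

theorem norm_eq_one_of_isUnit {z : Eisenstein} (hz : IsUnit z) : z.norm = 1 := by
  rcases Int.isUnit_iff.1 (QuadraticAlgebra.isUnit_iff_norm_isUnit.1 hz) with h | h
  · exact h
  · have := norm_nonneg z; omega

/-- The units of `ℤ[ω]` are `±1`, `±ω` and `±(1 + ω)`. -/
theorem eq_of_norm_eq_one {z : Eisenstein} (hz : z.norm = 1) :
    z = 1 ∨ z = -1 ∨ z = ⟨0, 1⟩ ∨ z = ⟨0, -1⟩ ∨ z = ⟨1, 1⟩ ∨ z = ⟨-1, -1⟩ := by
  obtain ⟨a, b⟩ := z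
  rw [norm_eq] at hz
  simp only at hz
  -- Four times the norm is 3a² + (a - 2b)², so 3a² ≤ 4; likewise for b.
  have ha : a ^ 2 ≤ 1 := by nlinarith [sq_nonneg (a - 2 * b)]
  have hb : b ^ 2 ≤ 1 := by nlinarith [sq_nonneg (b - 2 * a)]
  have ha1 : -1 ≤ a := by nlinarith
  have ha2 : a ≤ 1 := by nlinarith
  have hb1 : -1 ≤ b := by nlinarith
  have hb2 : b ≤ 1 := by nlinarith
  simp only [QuadraticAlgebra.ext_iff]
  interval_cases a <;> interval_cases b <;> simp_all [QuadraticAlgebra.re_one, QuadraticAlgebra.im_one]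

end Eisenstein

/-- A primitive element `x + 3yω` of `ℤ[ω]` prime to `3` whose norm is a cube is a cube. -/
theorem exists_cube_of_norm_eq_cube {x y n : ℤ} (hxy : IsCoprime x y) (hx : ¬ (3 : ℤ) ∣ x)
    (h : x ^ 2 - 3 * x * y + 9 * y ^ 2 = n ^ 3) :
    ∃ p q : ℤ, x = p ^ 3 + q ^ 3 - 3 * p * q ^ 2 ∧ y = p * q * (p - q) ∧
      n = p ^ 2 - p * q + q ^ 2 := by
  let μ : Eisenstein := ⟨x, 3 * y⟩
  have hμ : μ * star μ = (n : Eisenstein) ^ 3 := by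
    rw [← Int.cast_pow, ← h]
    ext
    · rw [QuadraticAlgebra.re_intCast]; simp [μ, QuadraticAlgebra.star_mk]; ring
    · rw [QuadraticAlgebra.im_intCast]; simp [μ, QuadraticAlgebra.star_mk]; ring
  have hcop : IsCoprime μ (star μ) := by
    have hx3 : IsCoprime x 9 :=
      (Int.prime_three.coprime_iff_not_dvd.2 hx).symm.pow_right (n := 2)
    obtain ⟨u, v, huv⟩ : IsCoprime (x ^ 2) (9 * y) := (hx3.mul_right hxy).pow_left
    -- The ideal (μ, `star μ`) contains 9y = -(1 + 2ω)(μ - `star μ`), since (1 + 2ω)² = -3, and x² =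
    -- (x - y - 2yω)μ + (y - yω)`star μ`. The witnesses combine these with the Bézout coefficients
    -- of x² and 9y.
    refine ⟨⟨u * x - u * y - v, -2 * u * y - 2 * v⟩,
      ⟨u * y + v, 2 * v - u * y⟩, ?_⟩
    ext
    · simp only [μ, QuadraticAlgebra.star_mk, QuadraticAlgebra.mk_mul_mk,
        QuadraticAlgebra.re_add, QuadraticAlgebra.re_one]
      linear_combination huv
    · simp only [μ, QuadraticAlgebra.star_mk, QuadraticAlgebra.mk_mul_mk,
        QuadraticAlgebra.im_add, QuadraticAlgebra.im_one]
      ring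
  obtain ⟨⟨p, q⟩, w, hw⟩ := exists_associated_pow_of_mul_eq_pow' hcop hμ
  have hcube : (⟨p, q⟩ : Eisenstein) ^ 3 =
      ⟨p ^ 3 + q ^ 3 - 3 * p * q ^ 2, 3 * (p * q * (p - q))⟩ := by
    rw [pow_succ, pow_two, QuadraticAlgebra.mk_mul_mk, QuadraticAlgebra.mk_mul_mk]
    ext <;> simp only <;> ring
  have hnorm : n = p ^ 2 - p * q + q ^ 2 := by
    have h1 := congrArg QuadraticAlgebra.norm hw
    rw [map_mul, Eisenstein.norm_eq_one_of_isUnit w.isUnit, map_pow, mul_one,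
      Eisenstein.norm_eq, Eisenstein.norm_eq] at h1
    simp only [μ] at h1
    exact (Odd.strictMono_pow (n := 3) (by decide)).injective (by linarith)
  rw [hcube] at hw
  rcases Eisenstein.eq_of_norm_eq_one (Eisenstein.norm_eq_one_of_isUnit w.isUnit) with
    h1 | h1 | h1 | h1 | h1 | h1 <;> rw [h1] at hw
  · rw [mul_one, QuadraticAlgebra.ext_iff] at hw
    simp only [μ] at hw
    exact ⟨p, q, by linarith, by linarith, hnorm⟩
  · rw [mul_neg_one, QuadraticAlgebra.neg_mk, QuadraticAlgebra.ext_iff] at hw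
    simp only [μ] at hw
    exact ⟨-p, -q, by linarith, by linarith, by linarith⟩
  -- For the units ±ω and ±(1 + ω), comparing coordinates with x + 3yω makes 3 divide x, because the
  -- cube has second coordinate divisible by 3.
  all_goals
    rw [QuadraticAlgebra.mk_mul_mk, QuadraticAlgebra.ext_iff] at hw
    simp only [μ] at hw
    refine absurd ?_ hx
    omega

/-! ### The descent -/

theorem exists_cubes_of_mul_eq_neg_cube {m N c : ℤ} (hco : IsCoprime m N) (h : m * N = -c ^ 3) :
    ∃ r n : ℤ, m = -r ^ 3 ∧ N = n ^ 3 ∧ c = r * n := by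
  have h1 : m * N = (-c) ^ 3 := by rw [h]; ring
  obtain ⟨d, hd⟩ := Int.eq_pow_of_mul_eq_pow_odd_left hco (k := 3) (by decide) h1
  obtain ⟨n, hn⟩ := Int.eq_pow_of_mul_eq_pow_odd_right hco (k := 3) (by decide) h1
  refine ⟨-d, n, by rw [hd]; ring, hn, ?_⟩
  refine (Odd.strictMono_pow (n := 3) (by decide)).injective ?_
  rw [hd, hn] at h
  linear_combination h

theorem not_prime_dvd_of_isCoprime {a b p : ℤ} (hab : IsCoprime a b) (hp : Prime p)
    (ha : p ∣ a) (hb : p ∣ b) : False :=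
  hp.not_isUnit (hab.isUnit_of_dvd' ha hb)

theorem isCoprime_of_forall_prime {a b : ℤ} (h : ∀ p : ℤ, Prime p → p ∣ a → p ∣ b → False) :
    IsCoprime a b := by
  refine isCoprime_of_prime_dvd (fun h0 => ?_) h
  exact h 2 Int.prime_two (by simp [h0.1]) (by simp [h0.2])

theorem dvd_or_dvd_of_dvd_mul_of_not_dvd {p a b : ℤ} (hp : Prime p) (k : ℤ) (hk : ¬ p ∣ k)
    (h : p ∣ k * (a * b)) : p ∣ a ∨ p ∣ b :=
  hp.dvd_or_dvd ((hp.dvd_or_dvd h).resolve_left hk)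

theorem five_dvd_add_of_curve {a b c : ℤ} (h : a ^ 3 + b ^ 3 + 5 * c ^ 3 = 5 * a * b * c) :
    (5 : ℤ) ∣ a + b := by
  -- Cubing is injective modulo 5.
  have key : ∀ x y : ZMod 5, x ^ 3 + y ^ 3 = 0 → x + y = 0 := by decide
  have h5 := congrArg (Int.cast : ℤ → ZMod 5) h
  push_cast at h5
  have e : (5 : ZMod 5) = 0 := rfl
  simp only [e, zero_mul, add_zero] at h5
  have := key _ _ h5
  exact (ZMod.intCast_zmod_eq_zero_iff_dvd (a + b) 5).1 (by push_cast; exact this)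

theorem ten_dvd_of_curve {a b c : ℤ} (h : a ^ 3 + b ^ 3 + 5 * c ^ 3 = 5 * a * b * c) :
    (10 : ℤ) ∣ 3 * (a + b) + 5 * c := by
  have h5 := five_dvd_add_of_curve h
  -- Modulo 2 the case of a, b, c all odd survives; modulo 4 it does not, and a + b + c comes out
  -- even.
  have key : ∀ x y z : ZMod 4, x ^ 3 + y ^ 3 + 5 * z ^ 3 = 5 * x * y * z →
      2 * (x + y + z) = 0 := by decide
  have h4 := congrArg (Int.cast : ℤ → ZMod 4) h
  push_cast at h4
  have := (ZMod.intCast_zmod_eq_zero_iff_dvd (2 * (a + b + c)) 4).1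
    (by push_cast; exact key _ _ _ h4)
  push_cast at this
  omega

/-- A primitive point of `a³ + b³ + 5c³ = 5abc` is the image of a point
`(p : q : r)` under an isogeny of degree `3`, here for `c` prime to `3`. -/
theorem exists_of_curve_of_not_three_dvd {a b c : ℤ} (hab : IsCoprime a b) (h3 : ¬ (3 : ℤ) ∣ c)
    (h : a ^ 3 + b ^ 3 + 5 * c ^ 3 = 5 * a * b * c) :
    ∃ p q r : ℤ, 3 * (a + b) + 5 * c = -10 * r ^ 3 ∧ 5 * c - 3 * b = p ^ 3 + q ^ 3 - 3 * p * q ^ 2 ∧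
      a - b = p * q * (p - q) ∧ c = r * (p ^ 2 - p * q + q ^ 2) := by
  obtain ⟨m, hm⟩ := ten_dvd_of_curve h
  -- With A = 3a, B = 3b, C = 5c the curve says A³ + B³ + C³ - 3ABC = -10c³. The cofactor of A + B +
  -- C = 10m is the norm of (C - B) + (A - B)ω.
  have hmN : m * ((5 * c - 3 * b) ^ 2 - 3 * (5 * c - 3 * b) * (a - b) + 9 * (a - b) ^ 2) =
      -c ^ 3 := by
    have : 10 * (m * ((5 * c - 3 * b) ^ 2 - 3 * (5 * c - 3 * b) * (a - b) + 9 * (a - b) ^ 2)) =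
      10 * -c ^ 3 := by
      rw [← mul_assoc, ← hm]
      linear_combination 27 * h
    linarith
  have hp3 : ∀ p : ℤ, Prime p → p ∣ c → ¬ p ∣ 3 := fun p hp hpc hp3 =>
    h3 (((hp.associated_of_dvd Int.prime_three hp3).symm.dvd).trans hpc)
  have hco : IsCoprime m
      ((5 * c - 3 * b) ^ 2 - 3 * (5 * c - 3 * b) * (a - b) + 9 * (a - b) ^ 2) := by
    refine isCoprime_of_forall_prime fun p hp hpm hpN => ?_
    have hpc : p ∣ c := hp.dvd_of_dvd_pow (dvd_neg.1 (hmN ▸ hpm.mul_right _))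
    have hp3' := hp3 p hp hpc
    have hpab : p ∣ a + b := by
      refine (hp.dvd_or_dvd (a := 3) ?_).resolve_left hp3'
      rw [show 3 * (a + b) = 10 * m - 5 * c by linarith]
      exact dvd_sub (hpm.mul_left _) (hpc.mul_left _)
    have h27 : p ∣ 27 * (a * b) := by
      rw [show 27 * (a * b) = 9 * (a + b) * (a + b) + c * (25 * c - 15 * a - 15 * b) -
        ((5 * c - 3 * b) ^ 2 - 3 * (5 * c - 3 * b) * (a - b) + 9 * (a - b) ^ 2) by ring]
      exact dvd_sub (dvd_add (hpab.mul_left _) (hpc.mul_right _)) hpN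
    rcases dvd_or_dvd_of_dvd_mul_of_not_dvd hp 27
      (fun h => hp3' (hp.dvd_of_dvd_pow (n := 3) (by norm_num; exact h))) h27 with h1 | h1
    · exact not_prime_dvd_of_isCoprime hab hp h1 ((dvd_add_right h1).1 hpab)
    · exact not_prime_dvd_of_isCoprime hab hp ((dvd_add_left h1).1 hpab) h1
  obtain ⟨r, n, hr, hn, hc⟩ := exists_cubes_of_mul_eq_neg_cube hco hmN
  have hxy : IsCoprime (5 * c - 3 * b) (a - b) := isCoprime_of_forall_prime fun p hp hpx hpy => by
    have hpc : p ∣ c := by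
      refine hp.dvd_of_dvd_pow (n := 3) (dvd_neg.1 (hmN ▸ Dvd.dvd.mul_left ?_ _))
      rw [show (5 * c - 3 * b) ^ 2 - 3 * (5 * c - 3 * b) * (a - b) + 9 * (a - b) ^ 2 =
        (5 * c - 3 * b) * (5 * c - 3 * b - 3 * (a - b)) + (a - b) * (9 * (a - b)) by ring]
      exact dvd_add (hpx.mul_right _) (hpy.mul_right _)
    have hpb : p ∣ b := by
      refine (hp.dvd_or_dvd (a := 3) ?_).resolve_left (hp3 p hp hpc)
      exact (dvd_sub_right (hpc.mul_left 5)).1 hpx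
    exact not_prime_dvd_of_isCoprime hab hp ((dvd_sub_left hpb).1 hpy) hpb
  obtain ⟨p, q, hx, hy, hpq⟩ := exists_cube_of_norm_eq_cube hxy (by omega) hn
  exact ⟨p, q, r, by rw [hm, hr]; ring, hx, hy, by rw [hc, hpq]⟩

/-- Here both factors of -10c³ are divisible by 3, so coprimality fails at first. The curve forces 9
∣ c and 270 ∣ 3(a + b) + 5c; once these powers of 3 are removed, the argument for c prime to 3
applies to the quotients. -/
theorem exists_of_curve_of_three_dvd {a b c : ℤ} (hab : IsCoprime a b) (h3 : (3 : ℤ) ∣ c)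
    (h : a ^ 3 + b ^ 3 + 5 * c ^ 3 = 5 * a * b * c) :
    ∃ p q r : ℤ, 3 * (a + b) + 5 * c = -10 * r ^ 3 ∧ 5 * c - 3 * b = p ^ 3 + q ^ 3 - 3 * p * q ^ 2 ∧
      a - b = p * q * (p - q) ∧ c = r * (p ^ 2 - p * q + q ^ 2) := by
  have h10 := ten_dvd_of_curve h
  obtain ⟨c', rfl⟩ := h3
  obtain ⟨m, hm⟩ : (3 : ℤ) ∣ a + b := by
    have h1 : (3 : ℤ) ∣ (a + b) ^ 3 :=
      ⟨a * b * (a + b) - 45 * c' ^ 3 + 5 * a * b * c', by linear_combination h⟩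
    exact Int.prime_three.dvd_of_dvd_pow h1
  have ha3 : ¬ (3 : ℤ) ∣ a * b := fun h1 => by
    rcases Int.prime_three.dvd_or_dvd h1 with h1 | h1
    · exact not_prime_dvd_of_isCoprime hab Int.prime_three h1 (by omega)
    · exact not_prime_dvd_of_isCoprime hab Int.prime_three (by omega) h1
  obtain rfl : a = 3 * m - b := by linarith
  -- Since 3 ∣ a + b, the sum a³ + b³ is divisible by 9, hence so is 15abc'.
  obtain ⟨n, rfl⟩ : (3 : ℤ) ∣ c' := by
    refine (Int.prime_three.dvd_or_dvd (a := (3 * m - b) * b) ?_).resolve_left ha3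
    have h5 : (3 : ℤ) ∣ 5 * ((3 * m - b) * b * c') :=
      ⟨m * (3 * m ^ 2 - (3 * m - b) * b) + 15 * c' ^ 3, by linarith⟩
    omega
  obtain ⟨k, hk⟩ : (3 : ℤ) ∣ m + 5 * n := by
    refine (Int.prime_three.dvd_or_dvd (a := (3 * m - b) * b) ?_).resolve_left ha3
    exact ⟨m ^ 3 + 135 * n ^ 3, by linarith⟩
  obtain rfl : m = 3 * k - 5 * n := by linarith
  obtain ⟨l, rfl⟩ : (10 : ℤ) ∣ k := by omega
  -- The element (5c - 3b) + 3(a - b)ω is (1 - ω)³ = -3 - 6ω times (b - 60l + 15n) + 3(5n - 10l)ω.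
  have hmN : l * ((b - 60 * l + 15 * n) ^ 2 - 3 * (b - 60 * l + 15 * n) * (5 * n - 10 * l) +
      9 * (5 * n - 10 * l) ^ 2) = -n ^ 3 := by
    linarith
  have hco : IsCoprime l ((b - 60 * l + 15 * n) ^ 2 -
      3 * (b - 60 * l + 15 * n) * (5 * n - 10 * l) + 9 * (5 * n - 10 * l) ^ 2) := by
    refine isCoprime_of_forall_prime fun p hp hpl hpN => ?_
    have hpn : p ∣ n := hp.dvd_of_dvd_pow (dvd_neg.1 (hmN ▸ hpl.mul_right _))
    have hpb : p ∣ b := by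
      refine hp.dvd_of_dvd_pow (n := 2) ?_
      rw [show b ^ 2 = (b - 60 * l + 15 * n) ^ 2 -
        3 * (b - 60 * l + 15 * n) * (5 * n - 10 * l) + 9 * (5 * n - 10 * l) ^ 2 +
        l * (90 * b - 2700 * l + 1350 * n) - n * (15 * b + 225 * n) by ring]
      exact dvd_sub (dvd_add hpN (hpl.mul_right _)) (hpn.mul_right _)
    refine not_prime_dvd_of_isCoprime hab hp (dvd_sub (Dvd.dvd.mul_left ?_ _) hpb) hpb
    exact dvd_sub ((hpl.mul_left _).mul_left _) (hpn.mul_left _)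
  obtain ⟨r, n', hr, hn, hc⟩ := exists_cubes_of_mul_eq_neg_cube hco hmN
  have hxy : IsCoprime (b - 60 * l + 15 * n) (5 * n - 10 * l) :=
    isCoprime_of_forall_prime fun p hp hpx hpy => by
      have hpn : p ∣ n := by
        refine hp.dvd_of_dvd_pow (n := 3) (dvd_neg.1 (hmN ▸ Dvd.dvd.mul_left ?_ _))
        rw [show (b - 60 * l + 15 * n) ^ 2 - 3 * (b - 60 * l + 15 * n) * (5 * n - 10 * l) +
          9 * (5 * n - 10 * l) ^ 2 = (b - 60 * l + 15 * n) * (b - 60 * l + 15 * n -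
          3 * (5 * n - 10 * l)) + (5 * n - 10 * l) * (9 * (5 * n - 10 * l)) by ring]
        exact dvd_add (hpx.mul_right _) (hpy.mul_right _)
      have hpl : p ∣ 10 * l := (dvd_sub_right (hpn.mul_left 5)).1 hpy
      have hpb : p ∣ b := by
        rw [show b = (b - 60 * l + 15 * n) + (10 * l) * 6 - n * 15 by ring]
        exact dvd_sub (dvd_add hpx (hpl.mul_right _)) (hpn.mul_right _)
      refine not_prime_dvd_of_isCoprime hab hp (dvd_sub (Dvd.dvd.mul_left ?_ _) hpb) hpb
      exact dvd_sub (hpl.mul_left _) (hpn.mul_left _)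
  obtain ⟨p, q, hx, hy, hpq⟩ := exists_cube_of_norm_eq_cube hxy
    (fun hd => ha3 (Dvd.dvd.mul_left (by omega) _)) hn
  -- The factor (1 - ω)³ is put back: (1 - ω)(p + qω) = (p + q) + (2q - p)ω, of norm 3(p² - pq +
  -- q²).
  refine ⟨p + q, 2 * q - p, 3 * r, ?_, ?_, ?_, ?_⟩
  · linear_combination 270 * hr
  · linear_combination (-3) * hx + 18 * hy
  · linear_combination (-2) * hx + 3 * hy
  · rw [hc, hpq]; ring

/-- A primitive solution of `uvw = 5s³`, `u + v + w = 5s` comes from a point of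
`a³ + b³ + 5c³ = 5abc`. -/
theorem exists_curve_of_primitive {u v w s : ℤ} (h : u * v * w = 5 * s ^ 3)
    (hs : u + v + w = 5 * s) (hprim : ∀ p : ℤ, Prime p → p ∣ u → p ∣ v → p ∣ w → False)
    (h5 : (5 : ℤ) ∣ w) :
    ∃ a b c : ℤ, s = a * b * c ∧ a ^ 3 + b ^ 3 + 5 * c ^ 3 = 5 * a * b * c ∧ IsCoprime a b := by
  have hp5 : Prime (5 : ℤ) := Int.prime_ofNat_iff.2 (by norm_num)
  have hds : ∀ p : ℤ, Prime p → ¬ p ∣ 5 → p ∣ u * v * w → p ∣ s := fun p hp h5 hd =>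
    hp.dvd_of_dvd_pow ((hp.dvd_or_dvd (h ▸ hd)).resolve_left h5)
  -- By the linear relation, a prime above 5 that divides w and one more of the three would divide
  -- all of them.
  have h5u : ∀ p : ℤ, Prime p → p ∣ 5 → p ∣ u → False := fun p hp hd hu => by
    have hw : p ∣ w := hd.trans h5
    refine hprim p hp hu ?_ hw
    rw [show v = 5 * s - w - u by linarith]
    exact dvd_sub (dvd_sub (hd.mul_right _) hw) hu
  have h5v : ∀ p : ℤ, Prime p → p ∣ 5 → p ∣ v → False := fun p hp hd hv => by
    have hw : p ∣ w := hd.trans h5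
    refine hprim p hp ?_ hv hw
    rw [show u = 5 * s - w - v by linarith]
    exact dvd_sub (dvd_sub (hd.mul_right _) hw) hv
  obtain ⟨w', rfl⟩ := h5
  -- A prime other than 5 that divides one of the factors divides s, so by the linear relation it
  -- cannot divide two of them. Hence u, v, w/5 are pairwise coprime with product s³, and each is a
  -- cube.
  have huv : IsCoprime u v := isCoprime_of_forall_prime fun p hp hu hv => by
    have hps := hds p hp (fun h => h5u p hp h hu) ((hu.mul_right _).mul_right _)
    refine hprim p hp hu hv ?_
    rw [show 5 * w' = 5 * s - u - v by linarith]
    exact dvd_sub (dvd_sub (hps.mul_left _) hu) hv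
  have huw : IsCoprime u w' := isCoprime_of_forall_prime fun p hp hu hw => by
    have hps := hds p hp (fun h => h5u p hp h hu) ((hu.mul_right _).mul_right _)
    refine hprim p hp hu ?_ (hw.mul_left _)
    rw [show v = 5 * s - u - 5 * w' by linarith]
    exact dvd_sub (dvd_sub (hps.mul_left _) hu) (hw.mul_left _)
  have hvw : IsCoprime v w' := isCoprime_of_forall_prime fun p hp hv hw => by
    have hps := hds p hp (fun h => h5v p hp h hv) ((hv.mul_left _).mul_right _)
    refine hprim p hp ?_ hv (hw.mul_left _)
    rw [show u = 5 * s - v - 5 * w' by linarith]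
    exact dvd_sub (dvd_sub (hps.mul_left _) hv) (hw.mul_left _)
  have hprod : u * v * w' = s ^ 3 := by linarith
  obtain ⟨a, ha⟩ := Int.eq_pow_of_mul_eq_pow_odd_left (huv.mul_right huw) (k := 3) (by decide)
    (show u * (v * w') = s ^ 3 by rw [← hprod]; ring)
  obtain ⟨b, hb⟩ := Int.eq_pow_of_mul_eq_pow_odd_left (huv.symm.mul_right hvw) (k := 3) (by decide)
    (show v * (u * w') = s ^ 3 by rw [← hprod]; ring)
  obtain ⟨c, hc⟩ := Int.eq_pow_of_mul_eq_pow_odd_right (huw.mul_left hvw) (k := 3) (by decide)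
    hprod
  have hsabc : s = a * b * c := by
    refine (Odd.strictMono_pow (n := 3) (by decide)).injective ?_
    rw [← hprod, ha, hb, hc]; ring
  refine ⟨a, b, c, hsabc, ?_, ?_⟩
  · rw [ha, hb, hc, hsabc] at hs
    linarith
  · rw [ha, hb] at huv
    exact (IsCoprime.pow_iff (by norm_num) (by norm_num)).1 huv

/-- The old s is abc = ab · r · (p² - pq + q²), and the new one is its divisor r. -/
theorem exists_smaller_of_five_dvd {u v w s : ℤ} (h : u * v * w = 5 * s ^ 3)
    (hs : u + v + w = 5 * s) (hs0 : s ≠ 0)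
    (hprim : ∀ p : ℤ, Prime p → p ∣ u → p ∣ v → p ∣ w → False) (h5 : (5 : ℤ) ∣ w) :
    ∃ u' v' w' s' : ℤ, u' * v' * w' = 5 * s' ^ 3 ∧ u' + v' + w' = 5 * s' ∧ s' ≠ 0 ∧
      s'.natAbs < s.natAbs := by
  obtain ⟨a, b, c, rfl, habc, hab⟩ := exists_curve_of_primitive h hs hprim h5
  obtain ⟨p, q, r, h1, h2, h3, h4⟩ : ∃ p q r : ℤ, 3 * (a + b) + 5 * c = -10 * r ^ 3 ∧
      5 * c - 3 * b = p ^ 3 + q ^ 3 - 3 * p * q ^ 2 ∧ a - b = p * q * (p - q) ∧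
      c = r * (p ^ 2 - p * q + q ^ 2) := by
    by_cases h : (3 : ℤ) ∣ c
    · exact exists_of_curve_of_three_dvd hab h habc
    · exact exists_of_curve_of_not_three_dvd hab h habc
  have hc0 : c ≠ 0 := right_ne_zero_of_mul hs0
  have hab0 : a * b ≠ 0 := left_ne_zero_of_mul hs0
  have hr0 : r ≠ 0 := left_ne_zero_of_mul (h4 ▸ hc0)
  have hN0 : p ^ 2 - p * q + q ^ 2 ≠ 0 := right_ne_zero_of_mul (h4 ▸ hc0)
  -- From (3(a + b) + 5c) + 2(5c - 3b) - 3(a - b) = 15c, elimination of a, b, c leaves a cubic in p,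
  -- q, r, which takes this product form.
  have hprod : (5 * r - p - q + 3 * p) * (5 * r - p - q) * (5 * r - p - q + 3 * q) =
      135 * r ^ 3 := by
    linear_combination -h1 - 2 * h2 + 3 * h3 + 15 * h4
  obtain ⟨t, ht⟩ : (3 : ℤ) ∣ 5 * r - p - q := by
    refine Int.prime_three.dvd_of_dvd_pow (n := 3) ⟨45 * r ^ 3 - (5 * r - p - q) *
      ((p + q) * (5 * r - p - q) + 3 * p * q), ?_⟩
    linear_combination hprod
  refine ⟨t + p, t, t + q, r, ?_, by linarith, hr0, ?_⟩
  · rw [ht] at hprod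
    linarith
  · rw [h4, Int.natAbs_mul, Int.natAbs_mul r, mul_left_comm]
    refine lt_mul_of_one_lt_right (Int.natAbs_pos.2 hr0) ?_
    have hN1 := Int.natAbs_pos.2 hN0
    have hab1 := Int.natAbs_pos.2 hab0
    -- Without a strict decrease |ab| = 1. Then 5 ∣ a + b forces a = -b, and the curve becomes 5c(c²
    -- + 1) = 0, against c ≠ 0.
    by_contra hle
    have hle' : (a * b).natAbs ≤ 1 := (Nat.le_mul_of_pos_right _ hN1).trans (not_lt.1 hle)
    have h1ab : (a * b).natAbs = 1 := by omega
    rw [Int.natAbs_mul, mul_eq_one] at h1ab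
    have h5ab := five_dvd_add_of_curve habc
    obtain rfl : a = -b := by omega
    have hb2 : b ^ 2 = 1 := by
      have := Int.natAbs_eq_iff.1 h1ab.2
      rcases this with h | h <;> simp [h]
    have : 5 * c * (c ^ 2 + 1) = 0 := by linear_combination habc + 5 * c * (-hb2)
    rcases mul_eq_zero.1 this with h | h
    · omega
    · nlinarith [sq_nonneg c]

theorem eq_zero_of_mul_eq_five_mul_cube {u v w s : ℤ} (h : u * v * w = 5 * s ^ 3)
    (hs : u + v + w = 5 * s) : s = 0 := by
  induction hn : s.natAbs using Nat.strong_induction_on generalizing u v w s with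
  | _ n ih =>
  by_contra hs0
  have hp5 : Prime (5 : ℤ) := Int.prime_ofNat_iff.2 (by norm_num)
  by_cases hprim : ∀ p : ℤ, Prime p → p ∣ u → p ∣ v → p ∣ w → False
  · have hred : ∃ u' v' w' s' : ℤ, u' * v' * w' = 5 * s' ^ 3 ∧ u' + v' + w' = 5 * s' ∧ s' ≠ 0 ∧
        s'.natAbs < s.natAbs := by
      rcases hp5.dvd_or_dvd (show (5 : ℤ) ∣ u * v * w from ⟨_, h⟩) with h5 | h5
      · rcases hp5.dvd_or_dvd h5 with h5 | h5
        · exact exists_smaller_of_five_dvd (u := v) (v := w) (w := u) (by linarith) (by linarith)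
            hs0 (fun p hp h1 h2 h3 => hprim p hp h3 h1 h2) h5
        · exact exists_smaller_of_five_dvd (u := w) (v := u) (w := v) (by linarith) (by linarith)
            hs0 (fun p hp h1 h2 h3 => hprim p hp h2 h3 h1) h5
      · exact exists_smaller_of_five_dvd h hs hs0 hprim h5
    obtain ⟨u', v', w', s', h1, h2, h3, h4⟩ := hred
    exact h3 (ih _ (hn ▸ h4) h1 h2 rfl)
  · push Not at hprim
    obtain ⟨p, hp, ⟨u', rfl⟩, ⟨v', rfl⟩, ⟨w', rfl⟩, -⟩ := hprim
    have hp0 := hp.ne_zero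
    -- Here p³ divides 5s³. When p is associated to 5, a factor 25 of s³ remains, so p still divides
    -- s and the whole solution can be divided by p.
    have hps : p ∣ s := by
      by_cases hp5' : p ∣ 5
      · obtain ⟨e, he⟩ := hp5.dvd_of_dvd_pow (n := 1)
          (show (5 : ℤ) ∣ p ^ 1 by simpa using (hp.associated_of_dvd hp5 hp5').symm.dvd)
        have h25 : (5 : ℤ) ∣ s ^ 3 :=
          ⟨5 * e ^ 3 * (u' * v' * w'), by subst he; linarith⟩
        exact (hp5'.trans (hp5.dvd_of_dvd_pow h25))
      · exact hp.dvd_of_dvd_pow ((hp.dvd_or_dvd (show p ∣ 5 * s ^ 3 from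
          ⟨p ^ 2 * (u' * v' * w'), by rw [← h]; ring⟩)).resolve_left hp5')
    obtain ⟨s', rfl⟩ := hps
    have hs0' : s' ≠ 0 := right_ne_zero_of_mul hs0
    refine hs0' (ih _ ?_ (u := u') (v := v') (w := w') ?_ ?_ rfl)
    · rw [← hn, Int.natAbs_mul]
      refine lt_mul_of_one_lt_left (Int.natAbs_pos.2 hs0') ?_
      exact (Int.prime_iff_natAbs_prime.1 hp).one_lt
    · exact mul_left_cancel₀ (pow_ne_zero 3 hp0) (by linear_combination h)
    · exact mul_left_cancel₀ hp0 (by linear_combination hs)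

theorem eq_zero_of_mul_eq_five_mul_cube_rat {u v w s : ℚ} (h : u * v * w = 5 * s ^ 3)
    (hs : u + v + w = 5 * s) : s = 0 := by
  obtain ⟨d, hd⟩ := IsLocalization.exist_integer_multiples_of_finset (nonZeroDivisors ℤ)
    ({u, v, w, s} : Finset ℚ)
  have hd0 : ((d : ℤ) : ℚ) ≠ 0 := by exact_mod_cast nonZeroDivisors.ne_zero d.2
  simp only [Finset.mem_insert, Finset.mem_singleton, forall_eq_or_imp, forall_eq,
    IsLocalization.IsInteger, RingHom.mem_rangeS, eq_intCast,
    zsmul_eq_mul] at hd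
  obtain ⟨⟨u', hu⟩, ⟨v', hv⟩, ⟨w', hw⟩, ⟨s', hs'⟩⟩ := hd
  have h1 : u' * v' * w' = 5 * s' ^ 3 := by
    have : (u' * v' * w' : ℚ) = 5 * s' ^ 3 := by
      rw [hu, hv, hw, hs']; linear_combination (d : ℤ) ^ 3 * h
    exact_mod_cast this
  have h2 : u' + v' + w' = 5 * s' := by
    have : (u' + v' + w' : ℚ) = 5 * s' := by
      rw [hu, hv, hw, hs']; linear_combination (d : ℤ) * hs
    exact_mod_cast this
  rw [eq_zero_of_mul_eq_five_mul_cube h1 h2, Int.cast_zero] at hs'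
  exact (mul_eq_zero.1 hs'.symm).resolve_left hd0

/-! ### Rational points -/

/-- In elementary symmetric functions the form is e₁³ - 2e₁e₂ + e₃, while (2e₁ - x)(2e₁ - y)(2e₁ -
z) = 4e₁³ + 2e₁e₂ - e₃. -/
theorem eval_sumMonomials_three (v : Fin 3 → ℚ) :
    eval v (sumMonomials 3) = 5 * (v 0 + v 1 + v 2) ^ 3 -
      (v 0 + 2 * v 1 + 2 * v 2) * (2 * v 0 + v 1 + 2 * v 2) * (2 * v 0 + 2 * v 1 + v 2) := by
  have h : Finset.Nat.antidiagonalTuple 3 3 = {![0, 0, 3], ![0, 1, 2], ![0, 2, 1], ![0, 3, 0],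
      ![1, 0, 2], ![1, 1, 1], ![1, 2, 0], ![2, 0, 1], ![2, 1, 0], ![3, 0, 0]} := by decide
  rw [sumMonomials, h]
  simp only [map_sum, map_mul, map_pow, eval_X]
  repeat rw [Finset.sum_insert (by decide)]
  rw [Finset.sum_singleton]
  simp
  ring

theorem eval_sumMonomials_three_eq_zero_iff (v : Fin 3 → ℚ) :
    eval v (sumMonomials 3) = 0 ↔ v 0 + v 1 + v 2 = 0 ∧ v 0 * v 1 * v 2 = 0 := by
  rw [eval_sumMonomials_three]
  constructor
  · intro h
    have hs : v 0 + v 1 + v 2 = 0 := eq_zero_of_mul_eq_five_mul_cube_rat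
      (u := v 0 + 2 * v 1 + 2 * v 2) (v := 2 * v 0 + v 1 + 2 * v 2) (w := 2 * v 0 + 2 * v 1 + v 2)
      (by linear_combination -h) (by ring)
    refine ⟨hs, ?_⟩
    have h0 : v 0 = -v 1 - v 2 := by linear_combination hs
    rw [h0] at h ⊢
    linear_combination h
  · rintro ⟨hs, hp⟩
    have h0 : v 0 = -v 1 - v 2 := by linear_combination hs
    rw [h0] at hp ⊢
    linear_combination hp

theorem rationalPoints_sumMonomials_three :
    PlaneCurve.rationalPoints (sumMonomials 3) =
      {Projectivization.mk ℚ ![1, -1, 0] (by simp),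
        Projectivization.mk ℚ ![-1, 0, 1] (by simp),
        Projectivization.mk ℚ ![0, 1, -1] (by simp)} := by
  ext P
  simp only [PlaneCurve.rationalPoints, Set.mem_ofPred_eq, Set.mem_insert_iff,
    Set.mem_singleton_iff]
  constructor
  · intro h
    induction P using Projectivization.ind with
    | h v hv =>
    obtain ⟨hs, hp⟩ := (eval_sumMonomials_three_eq_zero_iff v).1 (h v hv rfl)
    simp only [Projectivization.mk_eq_mk_iff']
    rcases mul_eq_zero.1 hp with hp | hp
    · rcases mul_eq_zero.1 hp with hp | hp
      · refine Or.inr (Or.inr ⟨v 1, ?_⟩)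
        ext i; fin_cases i <;> simp <;> linarith
      · refine Or.inr (Or.inl ⟨v 2, ?_⟩)
        ext i; fin_cases i <;> simp <;> linarith
    · refine Or.inl ⟨v 0, ?_⟩
      ext i; fin_cases i <;> simp <;> linarith
  · rintro (rfl | rfl | rfl) v hv h <;> rw [Projectivization.mk_eq_mk_iff'] at h <;>
      obtain ⟨a, rfl⟩ := h <;> rw [eval_sumMonomials_three_eq_zero_iff] <;> simp

theorem ncard_rationalPoints_sumMonomials_three :
    (PlaneCurve.rationalPoints (sumMonomials 3)).ncard = 3 := by
  rw [rationalPoints_sumMonomials_three, Set.ncard_eq_three]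
  refine ⟨_, _, _, ?_, ?_, ?_, rfl⟩ <;> rw [Ne, Projectivization.mk_eq_mk_iff'] <;>
    rintro ⟨a, ha⟩ <;> have h0 := congrFun ha 0 <;> have h1 := congrFun ha 1 <;>
    have h2 := congrFun ha 2 <;> simp at h0 h1 h2

/-! ### The curve `50a1` -/

theorem curve50a1_isElliptic : curve50a1.IsElliptic := by
  refine ⟨isUnit_iff_ne_zero.2 ?_⟩
  norm_num [curve50a1, WeierstrassCurve.Δ, WeierstrassCurve.b₂, WeierstrassCurve.b₄,
    WeierstrassCurve.b₆, WeierstrassCurve.b₈]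

theorem curve50a1_equation_iff (x y : ℚ) :
    curve50a1.toAffine.Equation x y ↔ x = 2 ∧ (y = 1 ∨ y = -4) := by
  rw [WeierstrassCurve.Affine.equation_iff]
  simp only [curve50a1]
  constructor
  · intro h
    -- These are the forms 2s - x, 2s - y, 2s - z and s evaluated at `toWeierstrass` of (x, y, 1).
    have hs := eq_zero_of_mul_eq_five_mul_cube_rat (u := 2 - 3 * x - y) (v := 3 - 2 * x + y)
      (w := 5) (s := 2 - x) (by linear_combination -5 * h) (by ring)
    obtain rfl : x = 2 := by linear_combination -hs
    refine ⟨rfl, ?_⟩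
    have : (y - 1) * (y + 4) = 0 := by linear_combination h
    rcases mul_eq_zero.1 this with h | h
    · exact Or.inl (by linear_combination h)
    · exact Or.inr (by linear_combination h)
  · rintro ⟨rfl, rfl | rfl⟩ <;> norm_num

theorem card_curve50a1_point : Nat.card curve50a1.toAffine.Point = 3 := by
  have := curve50a1_isElliptic
  have h1 : curve50a1.toAffine.Nonsingular 2 1 :=
    WeierstrassCurve.Affine.equation_iff_nonsingular.1
      ((curve50a1_equation_iff 2 1).2 ⟨rfl, Or.inl rfl⟩)
  have h2 : curve50a1.toAffine.Nonsingular 2 (-4) :=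
    WeierstrassCurve.Affine.equation_iff_nonsingular.1
      ((curve50a1_equation_iff 2 (-4)).2 ⟨rfl, Or.inr rfl⟩)
  rw [← Set.ncard_univ, Set.ncard_eq_three]
  refine ⟨.zero, .some _ _ h1, .some _ _ h2, by simp, by simp, by simp; norm_num, ?_⟩
  refine (Set.eq_univ_of_forall fun P => ?_).symm
  rcases P with _ | ⟨x, y, h⟩
  · simp
  · obtain ⟨rfl, rfl | rfl⟩ := (curve50a1_equation_iff x y).1 h.1 <;> simp

theorem rank_curve50a1_point : Module.rank ℤ curve50a1.toAffine.Point = 0 := by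
  rw [rank_eq_zero_iff]
  -- The group has order 3, so 3 kills every point.
  refine fun P => ⟨3, by norm_num, ?_⟩
  have := card_nsmul_eq_zero' (x := P)
  rw [card_curve50a1_point] at this
  exact_mod_cast this

/-! ### Linear changes of coordinates and plane curves -/

namespace AlgebraicGeometry.Proj

open CategoryTheory HomogeneousIdeal HomogeneousLocalization

universe u

variable {k A B : Type u} [CommRing k] [CommRing A] [CommRing B] [Algebra k A] [Algebra k B]
  {𝒜 : ℕ → Submodule k A} {ℬ : ℕ → Submodule k B} [GradedAlgebra 𝒜] [GradedAlgebra ℬ]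

theorem map_congr {f g : 𝒜 →+*ᵍ ℬ} (h : f = g) (hf : irrelevant ℬ ≤ (irrelevant 𝒜).map f)
    (hg : irrelevant ℬ ≤ (irrelevant 𝒜).map g) : map f hf = map g hg := by
  subst h; rfl

/-- The structure morphism of `Proj` of a graded `k`-algebra. -/
noncomputable def toSpecBase (𝒜 : ℕ → Submodule k A) [GradedAlgebra 𝒜] :
    Proj 𝒜 ⟶ Spec (CommRingCat.of k) :=
  toSpecZero 𝒜 ≫ Spec.map (CommRingCat.ofHom (algebraMap k (𝒜 0)))

theorem awayι_comp_map_toSpecBase (f : 𝒜 →+*ᵍ ℬ) (hf : irrelevant ℬ ≤ (irrelevant 𝒜).map f)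
    (hk : ∀ c : k, f (algebraMap k A c) = algebraMap k B c) {i : ℕ} (hi : 0 < i) (s : A)
    (hs : s ∈ 𝒜 i) :
    awayι ℬ (f s) (f.map_mem hs) hi ≫ map f hf ≫ toSpecBase 𝒜 =
      awayι ℬ (f s) (f.map_mem hs) hi ≫ toSpecBase ℬ := by
  have h : (Away.map f s).comp ((fromZeroRingHom 𝒜 (.powers s)).comp (algebraMap k (𝒜 0))) =
      (fromZeroRingHom ℬ (.powers (f s))).comp (algebraMap k (ℬ 0)) := by
    ext c
    change Localization.mk (f (algebraMap k A c)) ⟨f 1, _⟩ =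
      Localization.mk (algebraMap k B c) ⟨1, _⟩
    simp only [hk, map_one]
  rw [awayι_comp_map_assoc f hf hi s hs, toSpecBase, awayι_toSpecZero_assoc, toSpecBase,
    awayι_toSpecZero_assoc, ← Spec.map_comp, ← Spec.map_comp, ← Spec.map_comp,
    ← CommRingCat.ofHom_comp, ← CommRingCat.ofHom_comp, ← CommRingCat.ofHom_comp, ← h]

/-- The affine charts where f s is invertible, for s homogeneous of positive degree, cover the
source; on each one the equality is an identity of ring maps out of `k`. -/
theorem map_toSpecBase (f : 𝒜 →+*ᵍ ℬ) (hf : irrelevant ℬ ≤ (irrelevant 𝒜).map f)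
    (hk : ∀ c : k, f (algebraMap k A c) = algebraMap k B c) :
    map f hf ≫ toSpecBase 𝒜 = toSpecBase ℬ :=
  (mapAffineOpenCover f hf).openCover.hom_ext _ _ fun s =>
    awayι_comp_map_toSpecBase f hf hk s.1.2 _ s.2.2

/-- This inclusion is the condition for f to induce a morphism on all of `Proj ℬ`. -/
theorem irrelevant_le_map_of_surjective (f : 𝒜 →+*ᵍ ℬ)
    (h : ∀ n, ∀ b ∈ ℬ n, ∃ a ∈ 𝒜 n, f a = b) : irrelevant ℬ ≤ (irrelevant 𝒜).map f := by
  refine (irrelevant_le _).2 fun n hn b hb => ?_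
  obtain ⟨a, ha, rfl⟩ := h n b hb
  exact Ideal.mem_map_of_mem f (mem_irrelevant_of_mem _ hn ha)

/-- Mutually inverse homomorphisms of graded `k`-algebras give an isomorphism over `k`. -/
noncomputable def overIso (f : 𝒜 →+*ᵍ ℬ) (g : ℬ →+*ᵍ 𝒜) (hfg : ∀ a, g (f a) = a)
    (hgf : ∀ b, f (g b) = b) (hk : ∀ c : k, f (algebraMap k A c) = algebraMap k B c) :
    Over.mk (toSpecBase 𝒜) ≅ Over.mk (toSpecBase ℬ) :=
  have hf : irrelevant ℬ ≤ (irrelevant 𝒜).map f :=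
    irrelevant_le_map_of_surjective f fun _ b hb => ⟨g b, g.map_mem hb, hgf b⟩
  have hg : irrelevant 𝒜 ≤ (irrelevant ℬ).map g :=
    irrelevant_le_map_of_surjective g fun _ a ha => ⟨f a, f.map_mem ha, hfg a⟩
  Over.isoMk
    -- `Proj` is contravariant, so g gives the forward morphism.
    { hom := map g hg
      inv := map f hf
      hom_inv_id := (map_comp _ _ _ _).symm.trans
        ((map_congr (GradedRingHom.ext hfg) _ _).trans map_id)
      inv_hom_id := (map_comp _ _ _ _).symm.trans
        ((map_congr (GradedRingHom.ext hgf) _ _).trans map_id) }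
    (map_toSpecBase g hg fun c => by rw [← hk, hfg])

end AlgebraicGeometry.Proj

namespace PlaneCurve

universe u

variable {k : Type u} [Field k]

/-- The graded homomorphism between coordinate rings induced by a linear substitution. -/
noncomputable def gradedHom {F G : MvPolynomial (Fin 3) k} (l : Fin 3 → MvPolynomial (Fin 3) k)
    (hl : ∀ i, (l i).IsHomogeneous 1) (h : aeval l F ∈ Ideal.span {G}) :
    GradedRingHom (grading F) (grading G) where
  toRingHom := Ideal.quotientMap (Ideal.span {G}) (aeval l).toRingHom
    ((Ideal.span_singleton_le_iff_mem _).2 h)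
  map_mem := by
    rintro n _ ⟨p, hp, rfl⟩
    have := IsHomogeneous.aeval hp l hl
    rw [one_mul] at this
    exact mk_mem_grading G this

theorem gradedHom_gradedHom {F G : MvPolynomial (Fin 3) k}
    {l m : Fin 3 → MvPolynomial (Fin 3) k}
    (hl : ∀ i, (l i).IsHomogeneous 1) (hm : ∀ i, (m i).IsHomogeneous 1)
    (hF : aeval l F ∈ Ideal.span {G}) (hG : aeval m G ∈ Ideal.span {F})
    (hml : ∀ i, aeval m (l i) = X i) (a : CoordRing F) :
    gradedHom m hm hG (gradedHom l hl hF a) = a := by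
  obtain ⟨p, rfl⟩ := Ideal.Quotient.mk_surjective a
  have h : (aeval m).comp (aeval l) = AlgHom.id k (MvPolynomial (Fin 3) k) :=
    algHom_ext fun i => by rw [AlgHom.comp_apply, aeval_X, hml, AlgHom.id_apply]
  exact congrArg (Ideal.Quotient.mk (Ideal.span {F})) (DFunLike.congr_fun h p)

/-- Mutually inverse linear substitutions that exchange two plane curves give an isomorphism. -/
noncomputable def schemeIso {F G : MvPolynomial (Fin 3) k} {d e : ℕ} (hF : F.IsHomogeneous d)
    (hG : G.IsHomogeneous e) (l m : Fin 3 → MvPolynomial (Fin 3) k)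
    (hl : ∀ i, (l i).IsHomogeneous 1) (hm : ∀ i, (m i).IsHomogeneous 1)
    (hlF : aeval l F ∈ Ideal.span {G}) (hmG : aeval m G ∈ Ideal.span {F})
    (hml : ∀ i, aeval m (l i) = X i) (hlm : ∀ i, aeval l (m i) = X i) :
    scheme hF ≅ scheme hG :=
  letI := gradedAlgebra hF
  letI := gradedAlgebra hG
  AlgebraicGeometry.Proj.overIso (gradedHom l hl hlF) (gradedHom m hm hmG)
    (gradedHom_gradedHom hl hm hlF hmG hml) (gradedHom_gradedHom hm hl hmG hlF hlm)
    (fun c => congrArg (Ideal.Quotient.mk (Ideal.span {G})) (aeval_C (R := k) l c))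

end PlaneCurve

/-! ### The isomorphism between `C₃` and `50a1` -/

theorem sumMonomials_three_eq : sumMonomials 3 =
    C 5 * (X 0 + X 1 + X 2) ^ 3 - (X 0 + C 2 * X 1 + C 2 * X 2) *
      (C 2 * X 0 + X 1 + C 2 * X 2) * (C 2 * X 0 + C 2 * X 1 + X 2) :=
  -- This is `MvPolynomial.funext`: over the infinite field ℚ a polynomial is determined by its
  -- values.
  funext fun v => by rw [eval_sumMonomials_three]; simp

theorem curve50a1_polynomial : curve50a1.toProjective.polynomial =
    X 1 ^ 2 * X 2 + X 0 * X 1 * X 2 + X 1 * X 2 ^ 2 - X 0 ^ 3 + X 0 * X 2 ^ 2 + C 2 * X 2 ^ 3 := by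
  simp [WeierstrassCurve.Projective.polynomial, curve50a1]
  ring

/-- The linear substitution that carries `C₃` to `50a1`. -/
noncomputable def toWeierstrass : Fin 3 → MvPolynomial (Fin 3) ℚ :=
  ![X 0 + X 1 + C 2 * X 2, X 2 - X 1, C (-2) * X 0 - X 2]

/-- The inverse of the substitution `toWeierstrass`. -/
noncomputable def ofWeierstrass : Fin 3 → MvPolynomial (Fin 3) ℚ :=
  ![C (1 / 5) * (C (-3) * X 2 - X 0 - X 1), C (1 / 5) * (C 2 * X 0 - C 3 * X 1 + X 2),
    C (1 / 5) * (C 2 * X 0 + C 2 * X 1 + X 2)]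

theorem isHomogeneous_toWeierstrass (i : Fin 3) : (toWeierstrass i).IsHomogeneous 1 := by
  have h := isHomogeneous_X ℚ (σ := Fin 3)
  fin_cases i
  · exact ((h 0).add (h 1)).add ((h 2).C_mul _)
  · exact (h 2).sub (h 1)
  · exact ((h 0).C_mul _).sub (h 2)

theorem isHomogeneous_ofWeierstrass (i : Fin 3) : (ofWeierstrass i).IsHomogeneous 1 := by
  have h := isHomogeneous_X ℚ (σ := Fin 3)
  fin_cases i
  · exact ((((h 2).C_mul _).sub (h 0)).sub (h 1)).C_mul _
  · exact ((((h 0).C_mul _).sub ((h 1).C_mul _)).add (h 2)).C_mul _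
  · exact ((((h 0).C_mul _).add ((h 1).C_mul _)).add (h 2)).C_mul _

theorem aeval_ofWeierstrass_toWeierstrass (i : Fin 3) :
    aeval ofWeierstrass (toWeierstrass i) = X i := by
  refine funext fun v => ?_
  fin_cases i <;> simp [toWeierstrass, ofWeierstrass] <;> ring

theorem aeval_toWeierstrass_ofWeierstrass (i : Fin 3) :
    aeval toWeierstrass (ofWeierstrass i) = X i := by
  refine funext fun v => ?_
  fin_cases i <;> simp [toWeierstrass, ofWeierstrass] <;> ring

theorem aeval_toWeierstrass_sumMonomials_three :
    aeval toWeierstrass (sumMonomials 3) = C 5 * curve50a1.toProjective.polynomial := by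
  rw [sumMonomials_three_eq, curve50a1_polynomial]
  refine funext fun v => ?_
  simp [toWeierstrass]
  ring

theorem aeval_ofWeierstrass_polynomial :
    aeval ofWeierstrass curve50a1.toProjective.polynomial = C (1 / 5) * sumMonomials 3 := by
  rw [sumMonomials_three_eq, curve50a1_polynomial]
  refine funext fun v => ?_
  simp [ofWeierstrass]
  ring

/-- `C₃` and `50a1` are isomorphic over `ℚ`. -/
noncomputable def isoCurve50a1 : PlaneCurve.scheme (sumMonomials_isHomogeneous 3) ≅
    PlaneCurve.scheme (weierstrass_isHomogeneous curve50a1) :=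
  PlaneCurve.schemeIso _ _ toWeierstrass ofWeierstrass isHomogeneous_toWeierstrass
    isHomogeneous_ofWeierstrass
    (Ideal.mem_span_singleton.2 ⟨C 5, aeval_toWeierstrass_sumMonomials_three.trans (mul_comm _ _)⟩)
    (Ideal.mem_span_singleton.2 ⟨C (1 / 5), aeval_ofWeierstrass_polynomial.trans (mul_comm _ _)⟩)
    aeval_ofWeierstrass_toWeierstrass aeval_toWeierstrass_ofWeierstrass

theorem mainTheorem3 :
    PlaneCurve.rationalPoints (sumMonomials 3) =
      {Projectivization.mk ℚ ![1, -1, 0] (by simp),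
        Projectivization.mk ℚ ![-1, 0, 1] (by simp),
        Projectivization.mk ℚ ![0, 1, -1] (by simp)} ∧
    (PlaneCurve.rationalPoints (sumMonomials 3)).ncard = 3 ∧
    Nonempty (PlaneCurve.scheme (sumMonomials_isHomogeneous 3) ≅
      PlaneCurve.scheme (weierstrass_isHomogeneous curve50a1)) ∧
    curve50a1.IsElliptic ∧
    Module.rank ℤ curve50a1.toAffine.Point = 0 ∧
    Nat.card curve50a1.toAffine.Point = 3 :=
  ⟨rationalPoints_sumMonomials_three, ncard_rationalPoints_sumMonomials_three, ⟨isoCurve50a1⟩,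
    curve50a1_isElliptic, rank_curve50a1_point, card_curve50a1_point⟩
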